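/- A p-algebra is a bounded distributive lattice with a unary operation $^*$ such that $x\wedge y=0$ iff $x\le y^*$. Let $\bar{\mathbf B}_2$ be the four-element Boolean algebra with a new top element added above the old one, regarded as a p-algebra, and let $\mathsf{Pa}_2=\mathbf{HSP}(\bar{\mathbf B}_2)$ be the variety it generates. For a finite poset $X$ let $\varepsilon(X)$ be the p-algebra of upsets of $X$ ordered by inclusion, with $U^*=\{x\in X:\ \text{no } y\ge x \text{ lies in } U\}$, and let $\mathbf Q(\mathbf A)$ be the quasivariety of p-algebras generated by $\mathbf A$. Let $M=\{1,2,3\}$, and for a family $\mathcal F$ of non-empty subsets of $M$ let $P(M,\mathcal F)=\{M,\{1\},\{2\},\{3\}\}\cup\mathcal F$, ordered by reverse inclusion. Put $$P=P\big(M,\{\{1,2\}\}\big),\qquad Q=P\big(M,\{\{1,2\},\{2,3\}\}\big),\qquad R=P\big(M,\{\{1,2\},\{2,3\},\{1,3\}\}\big).$$ **Theorem.** $$\mathsf{Pa}_2\subsetneq\mathbf Q(\varepsilon(R))\subsetneq\mathbf Q(\varepsilon(Q))\subsetneq\mathbf Q(\varepsilon(P)),$$ and $\mathbf Q(\varepsilon(R))$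 is a cover of $\mathsf{Pa}_2$ in the lattice of quasivarieties of p-algebras. Consequently, neither $\mathbf Q(\varepsilon(Q))$ nor $\mathbf Q(\varepsilon(P))$ is a cover of $\mathsf{Pa}_2$; that is, among $P,Q,R$ only $R$ generates a cover. -/

import Mathlib

universe u v

/-- A (distributive) p-algebra: a bounded distributive lattice with a unary operation `ᶜ`
(the pseudocomplement, written `*` on paper) such that `x ⊓ y = ⊥` iff `x ≤ yᶜ`. -/
class PAlgebra (α : Type u) extends DistribLattice α, BoundedOrder α, Compl α where
  inf_eq_bot_iff : ∀ x y : α, x ⊓ y = ⊥ ↔ x ≤ yᶜ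

/-- The class `Pa` of all p-algebras (trivial ones included). -/
structure PAlg : Type (u + 1) where
  carrier : Type u
  [str : PAlgebra carrier]

namespace PAlg

instance : CoeSort PAlg.{u} (Type u) := ⟨PAlg.carrier⟩

instance (A : PAlg.{u}) : PAlgebra A := A.str

/-- Homomorphisms of p-algebras. -/
structure IsHom {α : Type u} {β : Type v} [PAlgebra α] [PAlgebra β] (f : α → β) : Prop where
  map_bot : f ⊥ = ⊥
  map_top : f ⊤ = ⊤
  map_inf : ∀ x y, f (x ⊓ y) = f x ⊓ f y
  map_sup : ∀ x y, f (x ⊔ y) = f x ⊔ f y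
  map_compl : ∀ x, f xᶜ = (f x)ᶜ

/-- The power `A ^ I`, with pointwise operations. -/
instance piPAlgebra (I : Type v) (α : Type u) [PAlgebra α] : PAlgebra (I → α) where
  inf_eq_bot_iff x y := by
    constructor
    · intro h i
      exact (PAlgebra.inf_eq_bot_iff (x i) (y i)).1 (congrFun h i)
    · intro h
      funext i
      exact (PAlgebra.inf_eq_bot_iff (x i) (y i)).2 (h i)

/-! ### Identities, quasi-identities and quasivarieties -/

/-- Terms in the language of p-algebras, with variables `x₀, x₁, …`. -/
inductive Term : Type
  | var : ℕ → Term
  | bot : Term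
  | top : Term
  | inf : Term → Term → Term
  | sup : Term → Term → Term
  | star : Term → Term

/-- The value of a term under an assignment of the variables. -/
def Term.eval {α : Type u} [PAlgebra α] (e : ℕ → α) : Term → α
  | .var n => e n
  | .bot => ⊥
  | .top => ⊤
  | .inf s t => s.eval e ⊓ t.eval e
  | .sup s t => s.eval e ⊔ t.eval e
  | .star s => (s.eval e)ᶜ

/-- A quasi-identity `s₁ = t₁ ∧ … ∧ sₙ = tₙ → s = t` (with `n = 0` allowed). -/
structure QuasiIdentity : Type where
  premises : List (Term × Term)
  lhs : Term
  rhs : Term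

/-- `A ⊨ q`: the quasi-identity `q` is valid in `A`. -/
def Satisfies (A : PAlg.{u}) (q : QuasiIdentity) : Prop :=
  ∀ e : ℕ → A, (∀ p ∈ q.premises, p.1.eval e = p.2.eval e) → q.lhs.eval e = q.rhs.eval e

/-- A quasivariety of p-algebras: the class of all p-algebras satisfying some set of
quasi-identities. -/
def IsQuasivariety (K : Set PAlg.{u}) : Prop :=
  ∃ S : Set QuasiIdentity, K = {A | ∀ q ∈ S, A.Satisfies q}

/-- `𝐐(A)`, the quasivariety generated by `A`: all p-algebras that satisfy every quasi-identity
valid in `A`. -/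
def Q (A : PAlg.{v}) : Set PAlg.{u} :=
  {B | ∀ q : QuasiIdentity, A.Satisfies q → B.Satisfies q}

theorem isQuasivariety_Q (A : PAlg.{v}) : IsQuasivariety (Q.{u, v} A) :=
  ⟨{q | A.Satisfies q}, rfl⟩

/-- `𝐐(A)` is the least quasivariety that contains `A`. -/
theorem isLeast_Q (A : PAlg.{u}) : IsLeast {K : Set PAlg.{u} | IsQuasivariety K ∧ A ∈ K} (Q A) := by
  refine ⟨⟨isQuasivariety_Q A, fun q hq => hq⟩, ?_⟩
  rintro K ⟨⟨S, rfl⟩, hA⟩ B hB q hq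
  exact hB q (hA q hq)

/-- `K ≺ L`: `L` covers `K` in the lattice of quasivarieties of p-algebras. -/
def IsCover (K L : Set PAlg.{u}) : Prop :=
  IsQuasivariety K ∧ IsQuasivariety L ∧ K ⊂ L ∧
    ∀ K' : Set PAlg.{u}, IsQuasivariety K' → K ⊆ K' → K' ⊆ L → K' = K ∨ K' = L

/-! ### The varieties `Pa_k` -/

/-- `𝐇𝐒𝐏(A)`: homomorphic images of algebras embeddable in powers of `A`. -/
def HSP (A : PAlg.{v}) : Set PAlg.{u} :=
  {B | ∃ (I : Type (max u v)) (C : PAlg.{max u v}) (f : C → (I → A)) (g : C → B),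
    IsHom f ∧ Function.Injective f ∧ IsHom g ∧ Function.Surjective g}

open Classical in
/-- A Boolean algebra with a new top element added above the old one. -/
noncomputable def addTop (β : Type u) [BooleanAlgebra β] : PAlg.{u} where
  carrier := WithTop β
  str :=
    { (inferInstance : DistribLattice (WithTop β)),
      (inferInstance : BoundedOrder (WithTop β)) with
      compl := fun x =>
        match x with
        | ⊤ => ⊥
        | (b : β) => if b = ⊥ then ⊤ else ((bᶜ : β) : WithTop β)
      inf_eq_bot_iff := by
        intro x y
        induction y using WithTop.recTopCoe with
        | top =>
          change x ⊓ ⊤ = ⊥ ↔ x ≤ ⊥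
          simp
        | coe b =>
          change x ⊓ (b : WithTop β) = ⊥ ↔
            x ≤ (if b = ⊥ then ⊤ else ((bᶜ : β) : WithTop β))
          split_ifs with hb
          · subst hb
            simp
          · induction x using WithTop.recTopCoe with
            | top => simpa using hb
            | coe a =>
              rw [← WithTop.coe_inf, ← WithTop.coe_bot, WithTop.coe_inj, WithTop.coe_le_coe,
                ← disjoint_iff, le_compl_iff_disjoint_right] }

/-- `B̄_k`: the Boolean algebra with `k` atoms, with an extra cover of its top element. -/
noncomputable def Bbar (k : ℕ) : PAlg.{0} := addTop (Set (Fin k))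

/-- `Pa_k = 𝐇𝐒𝐏(B̄_k)`. -/
def Pa (k : ℕ) : Set PAlg.{u} := HSP.{u, 0} (Bbar k)

/-! ### Dual p-algebras of posets -/

/-- The set of upsets of a poset `X`. -/
def Upset (X : Type u) [PartialOrder X] : Type u := {U : Set X // IsUpperSet U}

/-- `ε(X)`: the p-algebra of upsets of `X` ordered by inclusion, with intersection, union, `∅`,
`X`, and `U* = {x | no element above x lies in U}`. -/
def eps (X : Type u) [PartialOrder X] : PAlg.{u} where
  carrier := Upset X
  str :=
    { le := fun U V => U.1 ⊆ V.1
      le_refl := fun U => Set.Subset.refl U.1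
      le_trans := fun _ _ _ h k => Set.Subset.trans h k
      le_antisymm := fun _ _ h k => Subtype.ext (Set.Subset.antisymm h k)
      sup := fun U V => ⟨U.1 ∪ V.1, U.2.union V.2⟩
      inf := fun U V => ⟨U.1 ∩ V.1, U.2.inter V.2⟩
      le_sup_left := fun _ _ => Set.subset_union_left
      le_sup_right := fun _ _ => Set.subset_union_right
      sup_le := fun _ _ _ h k => Set.union_subset h k
      inf_le_left := fun _ _ => Set.inter_subset_left
      inf_le_right := fun _ _ => Set.inter_subset_right
      le_inf := fun _ _ _ h k => Set.subset_inter h k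
      le_sup_inf := fun U V W => (Set.union_inter_distrib_left U.1 V.1 W.1).symm.subset
      bot := ⟨∅, isUpperSet_empty⟩
      bot_le := fun U => Set.empty_subset U.1
      top := ⟨Set.univ, isUpperSet_univ⟩
      le_top := fun U => Set.subset_univ U.1
      compl := fun U => ⟨{x | ∀ y, x ≤ y → y ∉ U.1}, fun _ _ hxy hx z hz => hx z (hxy.trans hz)⟩
      inf_eq_bot_iff := by
        intro U V
        constructor
        · intro h x hx y hxy hy
          have hm : y ∈ U.1 ∩ V.1 := ⟨U.2 hxy hx, hy⟩
          have h' : U.1 ∩ V.1 = ∅ := congrArg Subtype.val h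
          rw [h'] at hm
          exact hm
        · intro h
          apply Subtype.ext
          apply Set.eq_empty_of_forall_notMem
          rintro x ⟨hxU, hxV⟩
          exact h hxU x le_rfl hxV }

/-! ### Reduced posets -/

/-- The (finite) reduced poset `P(M, F)` with base `M`: its elements are the set `M`, the
singletons `{m}` for `m ∈ M`, and the members of `F`. -/
def Reduced (M : Type u) [Fintype M] [DecidableEq M] (F : Finset (Finset M)) : Type u :=
  {A : Finset M // A = Finset.univ ∨ (∃ m : M, A = {m}) ∨ A ∈ F}

/-- `P(M, F)` is ordered by reverse inclusion. -/
instance (M : Type u) [Fintype M] [DecidableEq M] (F : Finset (Finset M)) :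
    PartialOrder (Reduced M F) where
  le A B := B.1 ⊆ A.1
  le_refl A := Finset.Subset.refl A.1
  le_trans _ _ _ h k := Finset.Subset.trans k h
  le_antisymm _ _ h k := Subtype.ext (Finset.Subset.antisymm k h)

/-- The base `M = {1, 2, 3}` is `Fin 3`, in which the numeral `3` denotes the element `0`.
`PosetP` is `P(M, {{1,2}})`. -/
abbrev PosetP : Type := Reduced (Fin 3) {{1, 2}}

/-- `P(M, {{1,2}, M - {1}})`. -/
abbrev PosetQ : Type := Reduced (Fin 3) {{1, 2}, Finset.univ \ {1}}

/-- `P(M, {{1,2}, M - {1}, M - {2}})`. -/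
abbrev PosetR : Type := Reduced (Fin 3) {{1, 2}, Finset.univ \ {1}, Finset.univ \ {2}}

end PAlg

/-! Lee's identity axiomatises $\mathsf{Pa}_2$. If it holds in `A`, every prime filter has at most
two maximal filters above it, so it yields a homomorphism to $\bar{\mathbf B}_2$, and these separate
points (`Lee.eq_of_toBbar_eq`). Hence $\mathsf{Pa}_2$ is also the quasivariety generated by
$\bar{\mathbf B}_2$.

The covering statement rests on `R` being the poset of all non-empty subsets of the base. An
assignment `e` in $\varepsilon(R)$ matters to `upsetTerm U` only through the map `block e` of the
base, and the value of that term is the inverse image of `U` along the induced self-map of `R`. So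
evaluating these terms is a homomorphism in `U`, which is a set of identities and passes to every
`A` in $\mathbf Q(\varepsilon(R))$. A failure of Lee's identity makes `block e` surjective, hence
the homomorphism injective; this too is a quasi-identity. Thus $\varepsilon(R)$ embeds in every
member of $\mathbf Q(\varepsilon(R))$ outside $\mathsf{Pa}_2$ (`eps_R_satisfies_of_not_lee`).

In the chain, inclusions come from maps of the base (`satisfies_of_base_maps`). Strictness comes
from quasi-identities on three disjoint elements in which some joins of two are assumed regular;
they detect which two-element sets belong to the poset. -/

namespace PAlg

/-! ### Pseudocomplements, homomorphisms and transfer of quasi-identities -/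

section Algebra

variable {α : Type u} {β : Type v} [PAlgebra α] [PAlgebra β]

theorem le_compl_iff {x y : α} : x ≤ yᶜ ↔ x ⊓ y = ⊥ := (PAlgebra.inf_eq_bot_iff x y).symm

theorem inf_compl_eq_bot (x : α) : x ⊓ xᶜ = ⊥ := by
  rw [inf_comm, ← le_compl_iff]

theorem compl_anti {x y : α} (h : x ≤ y) : yᶜ ≤ xᶜ :=
  le_compl_iff.2 (le_bot_iff.1 ((inf_le_inf_left _ h).trans (by rw [inf_comm, inf_compl_eq_bot])))

theorem compl_bot_eq : (⊥ : α)ᶜ = ⊤ := top_le_iff.1 (le_compl_iff.2 (inf_bot_eq _))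

theorem compl_top_eq : (⊤ : α)ᶜ = ⊥ := by
  have := inf_compl_eq_bot (⊤ : α)
  rwa [top_inf_eq] at this

theorem le_compl_compl (x : α) : x ≤ xᶜᶜ := le_compl_iff.2 (inf_compl_eq_bot x)

theorem compl_sup_eq (x y : α) : (x ⊔ y)ᶜ = xᶜ ⊓ yᶜ := by
  refine le_antisymm (le_inf (compl_anti le_sup_left) (compl_anti le_sup_right)) ?_
  rw [le_compl_iff, inf_sup_left, inf_assoc, inf_assoc, inf_comm yᶜ y, inf_comm yᶜ x,
    inf_compl_eq_bot, inf_bot_eq, sup_bot_eq, inf_left_comm, ← inf_assoc, inf_compl_eq_bot,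
    bot_inf_eq]

theorem IsHom.id : IsHom (fun x : α => x) := ⟨rfl, rfl, fun _ _ => rfl, fun _ _ => rfl, fun _ => rfl⟩

theorem IsHom.eval {f : α → β} (hf : IsHom f) (e : ℕ → α) (t : Term) :
    t.eval (fun n => f (e n)) = f (t.eval e) := by
  induction t with
  | var n => rfl
  | bot => exact hf.map_bot.symm
  | top => exact hf.map_top.symm
  | inf s t hs ht => simp only [Term.eval, hs, ht, hf.map_inf]
  | sup s t hs ht => simp only [Term.eval, hs, ht, hf.map_sup]
  | star s hs => simp only [Term.eval, hs, hf.map_compl]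

theorem isHom_apply {I : Type*} (i : I) : IsHom (fun x : I → α => x i) :=
  ⟨rfl, rfl, fun _ _ => rfl, fun _ _ => rfl, fun _ => rfl⟩

/-- Quasi-identities are inherited by algebras whose points are separated by homomorphisms. -/
theorem Satisfies.of_separating {A : PAlg.{u}} {B : PAlg.{v}} {I : Type*} (f : I → B → A)
    (hf : ∀ i, IsHom (f i)) (hsep : ∀ x y, (∀ i, f i x = f i y) → x = y) {q : QuasiIdentity}
    (hq : A.Satisfies q) : B.Satisfies q := by
  intro e he
  refine hsep _ _ fun i => ?_
  rw [← (hf i).eval, ← (hf i).eval]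
  refine hq _ fun p hp => ?_
  rw [(hf i).eval, (hf i).eval, he p hp]

/-- The copy of an algebra in a higher universe. -/
def lift (A : PAlg.{0}) : PAlg.{u} where
  carrier := PUnit.{u + 1} → A

theorem lift_satisfies (A : PAlg.{0}) (q : QuasiIdentity) :
    (lift.{u} A).Satisfies q ↔ A.Satisfies q := by
  constructor
  · refine Satisfies.of_separating (I := Unit) (fun _ x _ => x)
      (fun _ => ⟨rfl, rfl, fun _ _ => rfl, fun _ _ => rfl, fun _ => rfl⟩) fun x y h => ?_
    exact congrFun (h ()) PUnit.unit
  · exact Satisfies.of_separating (B := lift A) (I := PUnit.{u + 1})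
      (fun i (x : PUnit.{u + 1} → A) => x i) isHom_apply fun x y h => funext h

theorem Q_subset {A B : PAlg.{0}} (h : ∀ q : QuasiIdentity, B.Satisfies q → A.Satisfies q) :
    Q.{u, 0} A ⊆ Q B := fun _ hC q hq => hC q (h q hq)

/-- The generators live in the lowest universe and the classes in an arbitrary one, so the witness
of strictness is the lifted copy of `B`. -/
theorem Q_ssubset {A B : PAlg.{0}} (h : ∀ q : QuasiIdentity, B.Satisfies q → A.Satisfies q)
    (q : QuasiIdentity) (hA : A.Satisfies q) (hB : ¬ B.Satisfies q) : Q.{u, 0} A ⊂ Q B := by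
  refine ⟨Q_subset h, fun hsub => hB ?_⟩
  rw [← lift_satisfies.{u}]
  exact hsub (fun r hr => (lift_satisfies B r).2 hr) q hA

end Algebra

/-! ### Lee's identity and the variety `Pa 2` -/

/-- Three pairwise disjoint elements with dense join, in terms of two parameters; these are their
pseudocomplements. -/
def leeTerm : Fin 3 → Term :=
  ![.star (.var 0), .star (.inf (.var 1) (.star (.var 0))),
    .star (.inf (.star (.var 0)) (.star (.var 1)))]

/-- The identity `x* ∨ (y ∧ x*)* ∨ (x* ∧ y*)* = 1`. -/
def leeIdentity : QuasiIdentity :=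
  ⟨[], .sup (.sup (leeTerm 0) (leeTerm 1)) (leeTerm 2), .top⟩

/-- `x* ∨ (y ∧ x*)* ∨ (x* ∧ y*)* = 1` for all `x`, `y`. -/
def Lee (α : Type u) [PAlgebra α] : Prop :=
  ∀ x y : α, xᶜ ⊔ (y ⊓ xᶜ)ᶜ ⊔ (xᶜ ⊓ yᶜ)ᶜ = ⊤

theorem satisfies_leeIdentity_iff (A : PAlg.{u}) : A.Satisfies leeIdentity ↔ Lee A :=
  ⟨fun h x y => h (fun n => if n = 0 then x else y) (by simp [leeIdentity]),
    fun h e _ => h (e 0) (e 1)⟩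

/-- Disjointness gives `y ⊓ xᶜ = y` and `z ≤ xᶜ ⊓ yᶜ`, so the identity at `x`, `y` suffices because
`ᶜ` is antitone. -/
theorem Lee.of_disjoint {α : Type u} [PAlgebra α] (h : Lee α) {x y z : α} (hxy : y ⊓ x = ⊥)
    (hxz : z ⊓ x = ⊥) (hyz : z ⊓ y = ⊥) : xᶜ ⊔ yᶜ ⊔ zᶜ = ⊤ := by
  have := h x y
  rw [inf_eq_left.2 (le_compl_iff.2 hxy)] at this
  rw [← top_le_iff, ← this]
  exact sup_le_sup_left (compl_anti (le_inf (le_compl_iff.2 hxz) (le_compl_iff.2 hyz))) _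

/-! ### Prime filters and homomorphisms to $\bar{\mathbf B}_2$ -/

/-- Prime filters of a bounded distributive lattice. -/
structure IsPrimeFilter {α : Type u} [PAlgebra α] (F : Set α) : Prop where
  top_mem : ⊤ ∈ F
  bot_notMem : ⊥ ∉ F
  inf_mem_iff : ∀ x y, x ⊓ y ∈ F ↔ x ∈ F ∧ y ∈ F
  sup_mem_iff : ∀ x y, x ⊔ y ∈ F ↔ x ∈ F ∨ y ∈ F

theorem exists_isPrimeFilter {α : Type u} [PAlgebra α] {x y : α} (h : ¬ x ≤ y) :
    ∃ F : Set α, IsPrimeFilter F ∧ x ∈ F ∧ y ∉ F := by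
  obtain ⟨J, hJ, hyJ, hxJ⟩ := DistribLattice.prime_ideal_of_disjoint_filter_ideal
    (F := Order.PFilter.principal x) (I := Order.Ideal.principal y) (by
      rw [Set.disjoint_left]
      intro z hz hz'
      exact h (le_trans hz hz'))
  refine ⟨(J : Set α)ᶜ, ⟨?_, ?_, ?_, ?_⟩, ?_, ?_⟩
  · exact hJ.toIsProper.top_notMem
  · simp
  · intro a b
    simp only [Set.mem_compl_iff, SetLike.mem_coe, ← not_or, not_iff_not]
    exact ⟨hJ.mem_or_mem, fun h => h.elim (J.lower inf_le_left) (J.lower inf_le_right)⟩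
  · intro a b
    simp only [Set.mem_compl_iff, SetLike.mem_coe, Order.Ideal.sup_mem_iff]
    tauto
  · exact fun hx => Set.disjoint_left.1 hxJ (le_refl x : x ∈ Order.PFilter.principal x) hx
  · exact fun hy => hy (hyJ (le_refl y : y ∈ Order.Ideal.principal y))

namespace IsPrimeFilter

variable {α : Type u} [PAlgebra α] {F : Set α}

theorem mem_of_le (hF : IsPrimeFilter F) {x y : α} (h : x ≤ y) (hx : x ∈ F) : y ∈ F := by
  rw [← inf_eq_left.2 h, hF.inf_mem_iff] at hx
  exact hx.2

end IsPrimeFilter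

/-- A two-element family of elements that describes the maximal filters above a prime filter. -/
structure IsMaxPair {α : Type u} [PAlgebra α] (F : Set α) (p : Fin 2 → α) : Prop where
  compl_notMem : ∀ i, (p i)ᶜ ∉ F
  ultra : ∀ i x, (x ⊓ p i)ᶜ ∈ F ∨ (xᶜ ⊓ p i)ᶜ ∈ F
  dense : (p 0 ⊔ p 1)ᶜ = ⊥

/-- The element `p i` singles out one maximal filter above `F`, namely `{x | (x ⊓ p i)ᶜ ∉ F}`;
density of `p 0 ⊔ p 1` says that no other maximal filter lies above `F`. -/
theorem Lee.exists_isMaxPair {α : Type u} [PAlgebra α] (h : Lee α) {F : Set α}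
    (hF : IsPrimeFilter F) : ∃ p, IsMaxPair F p := by
  by_cases hex : ∃ a : α, aᶜ ∉ F ∧ aᶜᶜ ∉ F
  · obtain ⟨a, ha, ha'⟩ := hex
    -- Lee's identity for the disjoint elements `x ⊓ b`, `xᶜ ⊓ b`, `c`: primeness puts one
    -- pseudocomplement into `F`, and it is not `cᶜ`.
    have key : ∀ x b c : α, b ⊓ c = ⊥ → cᶜ ∉ F → (x ⊓ b)ᶜ ∈ F ∨ (xᶜ ⊓ b)ᶜ ∈ F := by
      intro x b c hbc hc
      have h1 : (x ⊓ b)ᶜ ⊔ (xᶜ ⊓ b)ᶜ ⊔ cᶜ = ⊤ := by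
        refine h.of_disjoint ?_ ?_ ?_
        · rw [inf_inf_inf_comm, inf_comm xᶜ, inf_compl_eq_bot, bot_inf_eq]
        · rw [inf_left_comm, inf_comm c, hbc, inf_bot_eq]
        · rw [inf_left_comm, inf_comm c, hbc, inf_bot_eq]
      have h2 := hF.top_mem
      rw [← h1, hF.sup_mem_iff, hF.sup_mem_iff] at h2
      tauto
    refine ⟨![a, aᶜ], ?_, ?_, ?_⟩
    · exact Fin.forall_fin_two.2 ⟨ha, ha'⟩
    · exact Fin.forall_fin_two.2 ⟨fun x => key x a aᶜ (inf_compl_eq_bot a) ha',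
        fun x => key x aᶜ a (by rw [inf_comm, inf_compl_eq_bot]) ha⟩
    · exact (compl_sup_eq a aᶜ).trans (inf_compl_eq_bot aᶜ)
  · push Not at hex
    -- Only one maximal filter lies above `F`; it is listed twice.
    refine ⟨fun _ => ⊤, ?_, ?_, ?_⟩
    · intro _
      rw [compl_top_eq]
      exact hF.bot_notMem
    · intro _ x
      rw [inf_top_eq, inf_top_eq]
      by_cases hx : xᶜ ∈ F
      · exact Or.inl hx
      · exact Or.inr (hex x hx)
    · rw [sup_top_eq, compl_top_eq]

open Classical in
/-- The map into `B̄₂` given by a prime filter and the maximal filters above it. -/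
noncomputable def toBbar {α : Type u} [PAlgebra α] (F : Set α) (p : Fin 2 → α) (x : α) :
    Bbar 2 :=
  if x ∈ F then (⊤ : WithTop (Set (Fin 2)))
  else (({i | (x ⊓ p i)ᶜ ∉ F} : Set (Fin 2)) : WithTop (Set (Fin 2)))

theorem Bbar_compl_top (k : ℕ) : Compl.compl (α := Bbar k) (⊤ : WithTop (Set (Fin k))) =
    ((∅ : Set (Fin k)) : WithTop (Set (Fin k))) := rfl

theorem Bbar_compl_empty (k : ℕ) :
    Compl.compl (α := Bbar k) ((∅ : Set (Fin k)) : WithTop (Set (Fin k))) =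
      (⊤ : WithTop (Set (Fin k))) := if_pos rfl

theorem Bbar_compl_coe {k : ℕ} {s : Set (Fin k)} (hs : s ≠ ∅) :
    Compl.compl (α := Bbar k) (s : WithTop (Set (Fin k))) =
      ((sᶜ : Set (Fin k)) : WithTop (Set (Fin k))) := if_neg hs

theorem toBbar_of_mem {α : Type u} [PAlgebra α] {F : Set α} {p : Fin 2 → α} {x : α}
    (hx : x ∈ F) : toBbar F p x = (⊤ : WithTop (Set (Fin 2))) := if_pos hx

theorem toBbar_of_notMem {α : Type u} [PAlgebra α] {F : Set α} {p : Fin 2 → α} {x : α}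
    (hx : x ∉ F) : toBbar F p x =
      (({i | (x ⊓ p i)ᶜ ∉ F} : Set (Fin 2)) : WithTop (Set (Fin 2))) := if_neg hx

namespace IsMaxPair

variable {α : Type u} [PAlgebra α] {F : Set α} {p : Fin 2 → α}

theorem compl_inf_mem_iff (hF : IsPrimeFilter F) (hp : IsMaxPair F p) (x y : α) (i : Fin 2) :
    (x ⊓ y ⊓ p i)ᶜ ∈ F ↔ (x ⊓ p i)ᶜ ∈ F ∨ (y ⊓ p i)ᶜ ∈ F := by
  constructor
  · intro h
    by_contra! hcon
    have hx := (hp.ultra i x).resolve_left hcon.1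
    have hy := (hp.ultra i y).resolve_left hcon.2
    refine hp.compl_notMem i (hF.mem_of_le ?_ ((hF.inf_mem_iff _ _).2
      ⟨h, (hF.inf_mem_iff _ _).2 ⟨hx, hy⟩⟩))
    -- Below `z ⊓ p i`, the elements `x ⊓ y`, `xᶜ` and `yᶜ` all vanish, which forces `z ⊓ p i = ⊥`.
    set z := (x ⊓ y ⊓ p i)ᶜ ⊓ ((xᶜ ⊓ p i)ᶜ ⊓ (yᶜ ⊓ p i)ᶜ) with hz
    have h1 : z ⊓ (x ⊓ y ⊓ p i) = ⊥ := le_compl_iff.1 inf_le_left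
    have h2 : z ⊓ (xᶜ ⊓ p i) = ⊥ := le_compl_iff.1 (inf_le_right.trans inf_le_left)
    have h3 : z ⊓ (yᶜ ⊓ p i) = ⊥ := le_compl_iff.1 (inf_le_right.trans inf_le_right)
    have h4 : z ⊓ p i ⊓ x ≤ yᶜ := le_compl_iff.2 (by rw [← h1]; ac_rfl)
    have h5 : z ⊓ p i ≤ xᶜ := le_compl_iff.2 (le_bot_iff.1 (by
      rw [← h3]
      exact le_inf (inf_le_left.trans inf_le_left) (le_inf h4 (inf_le_left.trans inf_le_right))))
    exact le_compl_iff.2 (le_bot_iff.1 (by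
      rw [← h2]
      exact le_inf inf_le_left (le_inf h5 inf_le_right)))
  · rintro (h | h)
    · exact hF.mem_of_le (compl_anti (inf_le_inf_right _ inf_le_left)) h
    · exact hF.mem_of_le (compl_anti (inf_le_inf_right _ inf_le_right)) h

theorem compl_sup_mem_iff (hF : IsPrimeFilter F) (x y z : α) :
    ((x ⊔ y) ⊓ z)ᶜ ∈ F ↔ (x ⊓ z)ᶜ ∈ F ∧ (y ⊓ z)ᶜ ∈ F := by
  rw [inf_sup_right, compl_sup_eq, hF.inf_mem_iff]

theorem compl_inf_notMem_of_mem (hF : IsPrimeFilter F) (hp : IsMaxPair F p) {x : α} (hx : x ∈ F)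
    (i : Fin 2) : (x ⊓ p i)ᶜ ∉ F := by
  intro h
  refine hp.compl_notMem i (hF.mem_of_le ?_ ((hF.inf_mem_iff _ _).2 ⟨hx, h⟩))
  rw [le_compl_iff]
  calc x ⊓ (x ⊓ p i)ᶜ ⊓ p i = (x ⊓ p i) ⊓ (x ⊓ p i)ᶜ := by ac_rfl
    _ = ⊥ := inf_compl_eq_bot _

theorem compl_mem_iff (hF : IsPrimeFilter F) (hp : IsMaxPair F p) (x : α) :
    xᶜ ∈ F ↔ ∀ i, (x ⊓ p i)ᶜ ∈ F := by
  constructor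
  · exact fun h i => hF.mem_of_le (compl_anti inf_le_left) h
  · intro h
    refine hF.mem_of_le ?_ ((hF.inf_mem_iff _ _).2 ⟨h 0, h 1⟩)
    rw [← compl_sup_eq, ← inf_sup_left, le_compl_iff, ← le_bot_iff, ← hp.dense, le_compl_iff,
      inf_assoc, inf_comm, inf_compl_eq_bot]

theorem compl_compl_inf_mem_iff (hF : IsPrimeFilter F) (hp : IsMaxPair F p) (x : α) (i : Fin 2) :
    (xᶜ ⊓ p i)ᶜ ∈ F ↔ (x ⊓ p i)ᶜ ∉ F := by
  constructor
  · intro h h'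
    refine hp.compl_notMem i ?_
    have h0 := (hp.compl_inf_mem_iff hF x xᶜ i).2 (Or.inl h')
    refine hF.mem_of_le ?_ ((hF.inf_mem_iff _ _).2 ⟨h', h⟩)
    set z := (x ⊓ p i)ᶜ ⊓ (xᶜ ⊓ p i)ᶜ with hz
    have h1 : z ⊓ (x ⊓ p i) = ⊥ := le_compl_iff.1 inf_le_left
    have h2 : z ⊓ (xᶜ ⊓ p i) = ⊥ := le_compl_iff.1 inf_le_right
    have h3 : z ⊓ p i ≤ xᶜ := le_compl_iff.2 (by rw [← h1]; ac_rfl)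
    exact le_compl_iff.2 (le_bot_iff.1 (by
      rw [← h2]
      exact le_inf inf_le_left (le_inf h3 inf_le_right)))
  · exact fun h => (hp.ultra i x).resolve_left h

/-- Members of `F` go to the new top, and any other element to the set of those of the two maximal
filters that contain it. Meets, joins and pseudocomplements are then checked by whether the
arguments lie in `F`. -/
theorem isHom_toBbar (hF : IsPrimeFilter F) (hp : IsMaxPair F p) : IsHom (toBbar F p) where
  map_bot := by
    rw [toBbar_of_notMem hF.bot_notMem]
    change ((_ : Set (Fin 2)) : WithTop (Set (Fin 2))) = ((∅ : Set (Fin 2)) : WithTop _)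
    congr 1
    ext i
    simp [compl_bot_eq, hF.top_mem]
  map_top := toBbar_of_mem hF.top_mem
  map_inf x y := by
    by_cases hx : x ∈ F
    · by_cases hy : y ∈ F
      · rw [toBbar_of_mem ((hF.inf_mem_iff _ _).2 ⟨hx, hy⟩), toBbar_of_mem hx, toBbar_of_mem hy]
        exact (inf_idem (⊤ : WithTop (Set (Fin 2)))).symm
      · rw [toBbar_of_notMem (fun h => hy ((hF.inf_mem_iff _ _).1 h).2), toBbar_of_mem hx,
          toBbar_of_notMem hy]
        refine Eq.trans ?_ (top_inf_eq (α := WithTop (Set (Fin 2))) _).symm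
        congr 1
        ext i
        simp [hp.compl_inf_mem_iff hF, hp.compl_inf_notMem_of_mem hF hx]
    · rw [toBbar_of_notMem (fun h => hx ((hF.inf_mem_iff _ _).1 h).1), toBbar_of_notMem hx]
      by_cases hy : y ∈ F
      · rw [toBbar_of_mem hy]
        refine Eq.trans ?_ (inf_top_eq (α := WithTop (Set (Fin 2))) _).symm
        congr 1
        ext i
        simp [hp.compl_inf_mem_iff hF, hp.compl_inf_notMem_of_mem hF hy]
      · rw [toBbar_of_notMem hy]
        refine Eq.trans ?_ (WithTop.coe_inf _ _)
        congr 1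
        ext i
        simp [hp.compl_inf_mem_iff hF]
  map_sup x y := by
    by_cases hx : x ∈ F
    · rw [toBbar_of_mem ((hF.sup_mem_iff _ _).2 (Or.inl hx)), toBbar_of_mem hx]
      exact (top_sup_eq (α := WithTop (Set (Fin 2))) _).symm
    · by_cases hy : y ∈ F
      · rw [toBbar_of_mem ((hF.sup_mem_iff _ _).2 (Or.inr hy)), toBbar_of_mem hy]
        exact (sup_top_eq (α := WithTop (Set (Fin 2))) _).symm
      · rw [toBbar_of_notMem (fun h => ((hF.sup_mem_iff _ _).1 h).elim hx hy),
          toBbar_of_notMem hx, toBbar_of_notMem hy]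
        refine Eq.trans ?_ (WithTop.coe_sup _ _)
        congr 1
        ext i
        simp only [Set.mem_ofPred_eq, compl_sup_mem_iff hF, Set.sup_eq_union, Set.mem_union]
        tauto
  map_compl x := by
    by_cases hc : xᶜ ∈ F
    · have hx : x ∉ F := fun hx => hF.bot_notMem (by
        rw [← inf_compl_eq_bot x]
        exact (hF.inf_mem_iff _ _).2 ⟨hx, hc⟩)
      have h0 : {i | (x ⊓ p i)ᶜ ∉ F} = (∅ : Set (Fin 2)) := by
        ext i
        simpa using (hp.compl_mem_iff hF x).1 hc i
      rw [toBbar_of_mem hc, toBbar_of_notMem hx, h0, Bbar_compl_empty]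
    · by_cases hx : x ∈ F
      · rw [toBbar_of_notMem hc, toBbar_of_mem hx, Bbar_compl_top]
        congr 1
        ext i
        simp [hp.compl_compl_inf_mem_iff hF, hp.compl_inf_notMem_of_mem hF hx]
      · have h0 : {i | (x ⊓ p i)ᶜ ∉ F} ≠ (∅ : Set (Fin 2)) := by
          intro h
          refine hc ((hp.compl_mem_iff hF x).2 fun i => ?_)
          by_contra hi
          exact (h ▸ hi : i ∈ (∅ : Set (Fin 2)))
        rw [toBbar_of_notMem hc, toBbar_of_notMem hx, Bbar_compl_coe h0]
        congr 1
        ext i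
        simp [hp.compl_compl_inf_mem_iff hF]

end IsMaxPair

/-- Prime filters together with a description of the maximal filters above them. -/
abbrev MaxPairs (α : Type u) [PAlgebra α] : Type u :=
  {Fp : Set α × (Fin 2 → α) // IsPrimeFilter Fp.1 ∧ IsMaxPair Fp.1 Fp.2}

theorem Lee.eq_of_toBbar_eq {α : Type u} [PAlgebra α] (h : Lee α) (x y : α)
    (hxy : ∀ i : MaxPairs α, toBbar i.1.1 i.1.2 x = toBbar i.1.1 i.1.2 y) : x = y := by
  have key : ∀ x y : α, (∀ i : MaxPairs α, toBbar i.1.1 i.1.2 x = toBbar i.1.1 i.1.2 y) →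
      x ≤ y := by
    intro x y hxy
    by_contra hle
    obtain ⟨F, hF, hx, hy⟩ := exists_isPrimeFilter hle
    obtain ⟨p, hp⟩ := h.exists_isMaxPair hF
    have := hxy ⟨(F, p), hF, hp⟩
    simp only [toBbar_of_mem hx, toBbar_of_notMem hy] at this
    exact WithTop.coe_ne_top this.symm
  exact le_antisymm (key x y hxy) (key y x fun i => (hxy i).symm)

theorem Lee.mem_Pa {A : PAlg.{u}} (h : Lee A) : A ∈ Pa.{u} 2 := by
  have key := fun i : MaxPairs A => i.2.2.isHom_toBbar i.2.1
  exact ⟨MaxPairs A, A, fun x i => toBbar i.1.1 i.1.2 x, fun x => x,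
    ⟨funext fun i => (key i).map_bot, funext fun i => (key i).map_top,
      fun x y => funext fun i => (key i).map_inf x y,
      fun x y => funext fun i => (key i).map_sup x y, fun x => funext fun i => (key i).map_compl x⟩,
    fun x y hxy => h.eq_of_toBbar_eq x y (congrFun hxy), IsHom.id, Function.surjective_id⟩

/-! ### Lee's identity axiomatises $\mathsf{Pa}_2$ -/

theorem lee_of_hom_injective {A : PAlg.{u}} {B : PAlg.{v}} {f : A → B} (hf : IsHom f)
    (hi : Function.Injective f) (h : Lee B) : Lee A := by
  rw [← satisfies_leeIdentity_iff] at h ⊢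
  exact h.of_separating (I := Unit) (fun _ => f) (fun _ => hf) fun x y hxy => hi (hxy ())

theorem lee_pi {A : PAlg.{u}} (I : Type v) (h : Lee A) : Lee (I → A) :=
  fun x y => funext fun i => h (x i) (y i)

theorem lee_of_surjective {A : PAlg.{u}} {B : PAlg.{v}} {f : A → B} (hf : IsHom f)
    (hs : Function.Surjective f) (h : Lee A) : Lee B := by
  intro x y
  obtain ⟨x, rfl⟩ := hs x
  obtain ⟨y, rfl⟩ := hs y
  have := congrArg f (h x y)
  simpa only [hf.map_sup, hf.map_compl, hf.map_inf, hf.map_top] using this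

end PAlg

namespace PAlg

/-- A failure would give three pairwise disjoint non-zero elements, each above an atom, but there
are only two atoms. -/
theorem lee_Bbar_two : Lee (Bbar 2) := by
  let _ : PAlgebra (WithTop (Set (Fin 2))) := (Bbar 2).str
  change ∀ x y : WithTop (Set (Fin 2)), xᶜ ⊔ (y ⊓ xᶜ)ᶜ ⊔ (xᶜ ⊓ yᶜ)ᶜ = ⊤
  have atom : ∀ z : WithTop (Set (Fin 2)), zᶜ ≠ ⊤ →
      ∃ i : Fin 2, (({i} : Set (Fin 2)) : WithTop (Set (Fin 2))) ≤ z := by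
    intro z hz
    induction z using WithTop.recTopCoe with
    | top => exact ⟨0, le_top⟩
    | coe s =>
      have hs : s ≠ ∅ := by
        rintro rfl
        exact hz (Bbar_compl_empty 2)
      obtain ⟨i, hi⟩ := Set.nonempty_iff_ne_empty.2 hs
      exact ⟨i, WithTop.coe_le_coe.2 (Set.singleton_subset_iff.2 hi)⟩
  have disj : ∀ (z w : WithTop (Set (Fin 2))) (i j : Fin 2), z ⊓ w = ⊥ →
      (({i} : Set (Fin 2)) : WithTop (Set (Fin 2))) ≤ z →
      (({j} : Set (Fin 2)) : WithTop (Set (Fin 2))) ≤ w → i ≠ j := by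
    rintro z w i _ h hi hj rfl
    have h1 : (({i} : Set (Fin 2)) : WithTop (Set (Fin 2))) ≤ ((∅ : Set (Fin 2)) : WithTop _) :=
      (le_inf hi hj).trans h.le
    simpa using WithTop.coe_le_coe.1 h1
  intro x y
  by_contra hne
  obtain ⟨i, hi⟩ := atom x fun h => hne (by rw [h, top_sup_eq, top_sup_eq])
  obtain ⟨j, hj⟩ := atom (y ⊓ xᶜ) fun h => hne (by rw [h, sup_top_eq, top_sup_eq])
  obtain ⟨k, hk⟩ := atom (xᶜ ⊓ yᶜ) fun h => hne (by rw [h, sup_top_eq])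
  have h1 := disj _ _ i j (le_compl_iff.1 (le_compl_compl x |>.trans
    (compl_anti inf_le_right))) hi hj
  have h2 := disj _ _ i k (le_compl_iff.1 (le_compl_compl x |>.trans
    (compl_anti inf_le_left))) hi hk
  have h3 := disj _ _ j k (le_compl_iff.1 (inf_le_left.trans ((le_compl_compl y).trans
    (compl_anti inf_le_right)))) hj hk
  omega

theorem mem_Pa_two_iff {A : PAlg.{u}} : A ∈ Pa.{u} 2 ↔ Lee A :=
  ⟨fun ⟨I, _, _, _, hf, hi, hg, hs⟩ => lee_of_surjective hg hs
    (lee_of_hom_injective (B := ⟨I → Bbar 2⟩) hf hi (lee_pi I lee_Bbar_two)), Lee.mem_Pa⟩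

theorem isQuasivariety_Pa_two : IsQuasivariety (Pa.{u} 2) :=
  ⟨{leeIdentity}, by
    ext A
    simp [mem_Pa_two_iff, satisfies_leeIdentity_iff]⟩

/-- Algebras in `Pa 2` satisfy the quasi-identities of `B̄₂`. -/
theorem satisfies_of_mem_Pa_two {A : PAlg.{u}} (hA : A ∈ Pa.{u} 2) {q : QuasiIdentity}
    (hq : (Bbar 2).Satisfies q) : A.Satisfies q := by
  have hL := mem_Pa_two_iff.1 hA
  exact hq.of_separating (fun i : MaxPairs A => toBbar i.1.1 i.1.2)
    (fun i => i.2.2.isHom_toBbar i.2.1) hL.eq_of_toBbar_eq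

/-! ### Algebras of upsets -/

section Eps

variable {X Y : Type} [PartialOrder X] [PartialOrder Y]

/-- The points of an element of `ε(X)`. -/
def pts (U : eps X) : Set X := Subtype.val (p := fun U : Set X => IsUpperSet U) U

/-- The element of `ε(X)` with a given set of points. -/
def ofUpper (U : Set X) (h : IsUpperSet U) : eps X := (⟨U, h⟩ : Upset X)

theorem pts_isUpperSet (U : eps X) : IsUpperSet (pts U) :=
  Subtype.property (p := fun U : Set X => IsUpperSet U) U

theorem pts_ext {U V : eps X} (h : ∀ x, x ∈ pts U ↔ x ∈ pts V) : U = V :=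
  Subtype.ext (p := fun U : Set X => IsUpperSet U) (Set.ext h)

theorem mem_pts_inf (U V : eps X) (x : X) : x ∈ pts (U ⊓ V) ↔ x ∈ pts U ∧ x ∈ pts V := Iff.rfl

theorem mem_pts_sup (U V : eps X) (x : X) : x ∈ pts (U ⊔ V) ↔ x ∈ pts U ∨ x ∈ pts V := Iff.rfl

theorem mem_pts_top (x : X) : x ∈ pts (⊤ : eps X) := trivial

theorem notMem_pts_bot (x : X) : x ∉ pts (⊥ : eps X) := fun h => h

theorem notMem_of_inf_eq_bot {U V : eps X} (h : U ⊓ V = ⊥) {x : X} (hU : x ∈ pts U) :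
    x ∉ pts V := by
  intro hV
  have hx := (mem_pts_inf U V x).2 ⟨hU, hV⟩
  rw [h] at hx
  exact notMem_pts_bot x hx

/-- Inverse image along an order-preserving map. -/
def preimage (f : X → Y) (hf : Monotone f) (U : eps Y) : eps X :=
  ofUpper (f ⁻¹' pts U) fun _ _ h hx => pts_isUpperSet U (hf h) hx

/-- The lifting condition is weaker than that of a p-morphism: reaching a point above `y` is enough,
since upsets are closed upwards. -/
theorem isHom_preimage {f : X → Y} (hf : Monotone f)
    (hlift : ∀ x y, f x ≤ y → ∃ x', x ≤ x' ∧ y ≤ f x') : IsHom (preimage f hf) where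
  map_bot := rfl
  map_top := rfl
  map_inf _ _ := rfl
  map_sup _ _ := rfl
  map_compl U := by
    refine pts_ext fun x => ⟨fun h x' hx' => h _ (hf hx'), fun h y hy hyU => ?_⟩
    obtain ⟨x', hx', hyx'⟩ := hlift x y hy
    exact h x' hx' (pts_isUpperSet U hyx' hyU)

theorem Satisfies.of_jointly_surjective {I : Type*} (f : I → X → Y) (hf : ∀ i, Monotone (f i))
    (hlift : ∀ i x y, f i x ≤ y → ∃ x', x ≤ x' ∧ y ≤ f i x') (hs : ∀ y, ∃ i x, f i x = y)
    {q : QuasiIdentity} (hq : (eps X).Satisfies q) : (eps Y).Satisfies q := by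
  refine hq.of_separating (fun i => preimage (f i) (hf i))
    (fun i => isHom_preimage (hf i) (hlift i)) fun U V h => pts_ext fun y => ?_
  obtain ⟨i, x, rfl⟩ := hs y
  exact Set.ext_iff.1 (congrArg pts (h i)) x

/-- Finite joins of terms. -/
def Term.sups (l : List Term) : Term := l.foldr .sup .bot

/-- Finite meets of terms. -/
def Term.infs (l : List Term) : Term := l.foldr .inf .top

theorem mem_pts_sups (e : ℕ → eps X) (l : List Term) (x : X) :
    x ∈ pts ((Term.sups l).eval e) ↔ ∃ t ∈ l, x ∈ pts (t.eval e) := by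
  induction l with
  | nil => exact iff_of_false (notMem_pts_bot x) (by simp)
  | cons t l ih =>
    rw [List.exists_mem_cons_iff, ← ih]
    exact Iff.rfl

theorem mem_pts_infs (e : ℕ → eps X) (l : List Term) (x : X) :
    x ∈ pts ((Term.infs l).eval e) ↔ ∀ t ∈ l, x ∈ pts (t.eval e) := by
  induction l with
  | nil => exact iff_of_true (mem_pts_top x) (by simp)
  | cons t l ih =>
    rw [List.forall_mem_cons, ← ih]
    exact Iff.rfl

end Eps

/-! ### Reduced posets with base of three elements -/

section Reduced

variable {F G : Finset (Finset (Fin 3))}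

/-- The condition for a set to be an element of `P(M, F)`. -/
abbrev IsMember (F : Finset (Finset (Fin 3))) (S : Finset (Fin 3)) : Prop :=
  S = Finset.univ ∨ (∃ m, S = {m}) ∨ S ∈ F

theorem Reduced.nonempty (hF : ∅ ∉ F) (S : Reduced (Fin 3) F) : S.1.Nonempty := by
  obtain ⟨S, rfl | ⟨m, rfl⟩ | hS⟩ := S
  · exact Finset.univ_nonempty
  · exact Finset.singleton_nonempty m
  · exact Finset.nonempty_iff_ne_empty.2 fun h => hF (h ▸ hS)

/-- The singletons, as elements of `P(M, F)`. -/
def single (m : Fin 3) : Reduced (Fin 3) F := ⟨{m}, Or.inr (Or.inl ⟨m, rfl⟩)⟩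

/-- The base, as an element of `P(M, F)`. -/
def base : Reduced (Fin 3) F := ⟨Finset.univ, Or.inl rfl⟩

theorem le_single {m : Fin 3} {S : Reduced (Fin 3) F} (h : m ∈ S.1) : S ≤ single m :=
  Finset.singleton_subset_iff.2 h

/-- The maximal points are the singletons, and every point lies below one of them, so only the
singletons in `U` affect its pseudocomplement. -/
theorem mem_pts_compl_iff (hF : ∅ ∉ F) (U : eps (Reduced (Fin 3) F)) (S : Reduced (Fin 3) F) :
    S ∈ pts Uᶜ ↔ ∀ m ∈ S.1, single m ∉ pts U := by
  refine ⟨fun h m hm => h _ (le_single hm), fun h T hST hT => ?_⟩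
  obtain ⟨m, hm⟩ := T.nonempty hF
  exact h m (hST hm) (pts_isUpperSet U (le_single hm) hT)

/-- Direct image under `τ` is monotone and sends singletons to singletons, hence satisfies the
lifting condition; joint surjectivity makes the inverse images separate points. -/
theorem satisfies_of_base_maps (hG : ∅ ∉ G)
    (h : ∀ S, IsMember G S → ∃ τ : Fin 3 → Fin 3,
      (∀ T, IsMember F T → IsMember G (T.image τ)) ∧ ∃ T, IsMember F T ∧ T.image τ = S)
    {q : QuasiIdentity} (hq : (eps (Reduced (Fin 3) F)).Satisfies q) :
    (eps (Reduced (Fin 3) G)).Satisfies q := by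
  refine hq.of_jointly_surjective (I := {τ : Fin 3 → Fin 3 //
    ∀ T, IsMember F T → IsMember G (T.image τ)}) (X := Reduced (Fin 3) F) (Y := Reduced (Fin 3) G)
    (fun τ T => ⟨T.1.image τ.1, τ.2 T.1 T.2⟩)
    (fun τ S T hST => Finset.image_subset_image hST) ?_ ?_
  · intro τ S T hT
    obtain ⟨m, hm⟩ := T.nonempty hG
    obtain ⟨k, hk, rfl⟩ := Finset.mem_image.1 (hT hm)
    refine ⟨single k, le_single hk, ?_⟩
    change Finset.image τ.1 {k} ⊆ T.1
    simpa using hm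
  · rintro ⟨S, hS⟩
    obtain ⟨τ, hτ, T, hT, rfl⟩ := h S hS
    exact ⟨⟨τ, hτ⟩, ⟨T, hT⟩, rfl⟩

/-! ### Separating quasi-identities -/

/-- Terms saying that the first three variables are pairwise disjoint. -/
def disjointPremises : List (Term × Term) :=
  [(.inf (.var 0) (.var 1), .bot), (.inf (.var 0) (.var 2), .bot), (.inf (.var 1) (.var 2), .bot)]

/-- `x_i ∨ x_j` is regular. -/
def regularPremise (i j : ℕ) : Term × Term :=
  (.star (.star (.sup (.var i) (.var j))), .sup (.var i) (.var j))

/-- From three disjoint elements and some further premises, `x₀* ∨ x₁* ∨ x₂* = 1`. -/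
def disjointQuasiIdentity (l : List (Term × Term)) : QuasiIdentity :=
  ⟨disjointPremises ++ l,
    .sup (.sup (.star (.var 0)) (.star (.var 1))) (.star (.var 2)), .top⟩

/-- The maximal points above `{a, b}` lie in `U ⊔ V`, so regularity puts `{a, b}` itself in `U` or
in `V`. That upset then contains both singletons, against disjointness. -/
theorem no_pair_of_regular (hF : ∅ ∉ F) {U V : eps (Reduced (Fin 3) F)} (hUV : U ⊓ V = ⊥)
    (hreg : (U ⊔ V)ᶜᶜ = U ⊔ V) {a b : Fin 3} (ha : single a ∈ pts U) (hb : single b ∈ pts V) :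
    ¬ IsMember F {a, b} := by
  intro hab
  let S : Reduced (Fin 3) F := ⟨{a, b}, hab⟩
  have haS : S ≤ single a := le_single (Finset.mem_insert_self a {b})
  have hbS : S ≤ single b :=
    le_single (Finset.mem_insert_of_mem (Finset.mem_singleton_self b))
  have hS : S ∈ pts (U ⊔ V)ᶜᶜ := by
    rw [mem_pts_compl_iff hF]
    intro m hm h
    rw [mem_pts_compl_iff hF] at h
    refine h m (Finset.mem_singleton_self m) ?_
    rcases Finset.mem_insert.1 hm with rfl | hm
    · exact Or.inl ha
    · rw [Finset.mem_singleton.1 hm]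
      exact Or.inr hb
  rw [hreg] at hS
  rcases hS with hS | hS
  · exact notMem_of_inf_eq_bot hUV (pts_isUpperSet U hbS hS) hb
  · exact notMem_of_inf_eq_bot hUV ha (pts_isUpperSet V haS hS)

theorem satisfies_disjointQuasiIdentity (hF : ∅ ∉ F) (l : List (ℕ × ℕ))
    (h : ∀ m : Fin 3 → Fin 3, m 0 ≠ m 1 → m 0 ≠ m 2 → m 1 ≠ m 2 →
      ((0, 2) ∈ l ∧ IsMember F {m 0, m 2}) ∨ ((1, 2) ∈ l ∧ IsMember F {m 1, m 2})) :
    (eps (Reduced (Fin 3) F)).Satisfies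
      (disjointQuasiIdentity (l.map fun p => regularPremise p.1 p.2)) := by
  intro e he
  have h01 : e 0 ⊓ e 1 = ⊥ := he (.inf (.var 0) (.var 1), .bot) (by
    simp [disjointQuasiIdentity, disjointPremises])
  have h02 : e 0 ⊓ e 2 = ⊥ := he (.inf (.var 0) (.var 2), .bot) (by
    simp [disjointQuasiIdentity, disjointPremises])
  have h12 : e 1 ⊓ e 2 = ⊥ := he (.inf (.var 1) (.var 2), .bot) (by
    simp [disjointQuasiIdentity, disjointPremises])
  have hreg : ∀ i j, (i, j) ∈ l → (e i ⊔ e j)ᶜᶜ = e i ⊔ e j := fun i j hij =>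
    he (regularPremise i j) (List.mem_append_right _ (List.mem_map_of_mem hij))
  have hdisj : ∀ {U V : eps (Reduced (Fin 3) F)}, U ⊓ V = ⊥ → ∀ {a b : Fin 3},
      single a ∈ pts U → single b ∈ pts V → a ≠ b := by
    rintro U V hUV a _ ha hb rfl
    exact notMem_of_inf_eq_bot hUV ha hb
  refine pts_ext fun S => ⟨fun _ => mem_pts_top S, fun _ => ?_⟩
  change (S ∈ pts (e 0)ᶜ ∨ S ∈ pts (e 1)ᶜ) ∨ S ∈ pts (e 2)ᶜ
  simp only [mem_pts_compl_iff hF]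
  by_contra! hcon
  obtain ⟨⟨⟨a, -, ha⟩, b, -, hb⟩, c, -, hc⟩ := hcon
  rcases h ![a, b, c] (hdisj h01 ha hb) (hdisj h02 ha hc) (hdisj h12 hb hc) with ⟨hl, hm⟩ | ⟨hl, hm⟩
  · exact no_pair_of_regular hF h02 (hreg _ _ hl) ha hc hm
  · exact no_pair_of_regular hF h12 (hreg _ _ hl) hb hc hm

/-- The upset `{{m}}`. -/
def atomUpset (hF : ∅ ∉ F) (m : Fin 3) : eps (Reduced (Fin 3) F) :=
  ofUpper {single m} (by
    rintro _ T hT rfl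
    exact Subtype.ext ((T.nonempty hF).subset_singleton_iff.1 hT))

theorem single_mem_pts_atomUpset (hF : ∅ ∉ F) {a b : Fin 3} :
    single a ∈ pts (atomUpset hF b) ↔ a = b :=
  ⟨fun h => Finset.singleton_injective (congrArg Subtype.val h), fun h => h ▸ rfl⟩

/-- The counterexample consists of the three atoms: a join of two is regular when no further member
of the poset lies inside the corresponding pair, and `base` lies in none of the three
pseudocomplements. -/
theorem not_satisfies_disjointQuasiIdentity (hF : ∅ ∉ F) (l : List (ℕ × ℕ)) (m : ℕ → Fin 3)
    (h01 : m 0 ≠ m 1) (h02 : m 0 ≠ m 2) (h12 : m 1 ≠ m 2)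
    (h : ∀ p ∈ l, ∀ S, IsMember F S → S ⊆ {m p.1, m p.2} → S = {m p.1} ∨ S = {m p.2}) :
    ¬ (eps (Reduced (Fin 3) F)).Satisfies
      (disjointQuasiIdentity (l.map fun p => regularPremise p.1 p.2)) := by
  intro hsat
  have hdisj : ∀ {a b : Fin 3}, a ≠ b → atomUpset hF a ⊓ atomUpset hF b = ⊥ := by
    intro a b hab
    refine pts_ext fun S => ⟨fun hS => hab ?_, fun hS => (notMem_pts_bot S hS).elim⟩
    obtain ⟨h1, h2⟩ := hS
    exact Finset.singleton_injective
      ((congrArg Subtype.val h1).symm.trans (congrArg Subtype.val h2))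
  have := hsat (fun n => atomUpset hF (m n)) (by
    intro p hp
    rcases List.mem_append.1 hp with hp | hp
    · simp only [disjointPremises, List.mem_cons, List.not_mem_nil, or_false] at hp
      rcases hp with rfl | rfl | rfl
      · exact hdisj h01
      · exact hdisj h02
      · exact hdisj h12
    · obtain ⟨⟨i, j⟩, hij, rfl⟩ := List.mem_map.1 hp
      refine le_antisymm ?_ (le_compl_compl _)
      intro S hS
      have hS' := (mem_pts_compl_iff hF _ S).1 hS
      have hsub : S.1 ⊆ {m i, m j} := by
        intro k hk
        by_contra hk'
        refine hS' k hk ((mem_pts_compl_iff hF _ _).2 fun k' h1 h2 => ?_)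
        rw [Finset.mem_singleton.1 h1] at h2
        rcases h2 with h2 | h2
        · exact hk' (by simp [(single_mem_pts_atomUpset hF).1 h2])
        · exact hk' (by simp [(single_mem_pts_atomUpset hF).1 h2])
      rcases h _ hij S.1 S.2 hsub with h1 | h1
      · exact Or.inl (Subtype.ext h1)
      · exact Or.inr (Subtype.ext h1))
  have hbase : base ∈ pts (⊤ : eps (Reduced (Fin 3) F)) := mem_pts_top _
  rw [← show _ = (⊤ : eps (Reduced (Fin 3) F)) from this] at hbase
  have hnot : ∀ a, base ∉ pts (atomUpset hF a)ᶜ := fun a ha =>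
    (mem_pts_compl_iff hF _ _).1 ha a (Finset.mem_univ a) ((single_mem_pts_atomUpset hF).2 rfl)
  rcases hbase with (hb | hb) | hb
  · exact hnot _ hb
  · exact hnot _ hb
  · exact hnot _ hb

end Reduced

end PAlg

namespace PAlg

/-! ### The algebra `ε(R)` -/

theorem isMember_R (S : Finset (Fin 3)) (hS : S.Nonempty) :
    IsMember {{1, 2}, Finset.univ \ {1}, Finset.univ \ {2}} S := by
  revert S
  decide

theorem PosetR.nonempty (S : PosetR) : S.1.Nonempty := Reduced.nonempty (by decide) S

/-- The map of `R` induced by a map of its base. -/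
def PosetR.image (σ : Fin 3 → Fin 3) (S : PosetR) : PosetR :=
  ⟨S.1.image σ, isMember_R _ (S.nonempty.image σ)⟩

open Classical in
/-- The block of a point of the base in the partition described by two upsets. -/
noncomputable def block (e : ℕ → eps PosetR) (m : Fin 3) : Fin 3 :=
  if single m ∈ pts (e 0) then 0 else if single m ∈ pts (e 1) then 1 else 2

/-- The singletons in `e 0`, in `e 1 ⊓ (e 0)ᶜ` and in `(e 0)ᶜ ⊓ (e 1)ᶜ` are those of the points in
the three blocks. -/
theorem mem_pts_leeTerm (e : ℕ → eps PosetR) (i : Fin 3) (S : PosetR) :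
    S ∈ pts ((leeTerm i).eval e) ↔ ∀ m ∈ S.1, block e m ≠ i := by
  have hF : ∅ ∉ ({{1, 2}, Finset.univ \ {1}, Finset.univ \ {2}} : Finset (Finset (Fin 3))) := by
    decide
  have hs : ∀ (U : eps PosetR) m, single m ∈ pts Uᶜ ↔ single m ∉ pts U := by
    intro U m
    rw [mem_pts_compl_iff hF]
    simp [single]
  fin_cases i
  · refine (mem_pts_compl_iff hF (e 0) S).trans (forall₂_congr fun m _ => ?_)
    unfold block
    split_ifs <;> simp_all
  · refine (mem_pts_compl_iff hF (e 1 ⊓ (e 0)ᶜ) S).trans (forall₂_congr fun m _ => ?_)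
    rw [mem_pts_inf, hs]
    unfold block
    split_ifs <;> simp_all
  · refine (mem_pts_compl_iff hF ((e 0)ᶜ ⊓ (e 1)ᶜ) S).trans (forall₂_congr fun m _ => ?_)
    rw [mem_pts_inf, hs, hs]
    unfold block
    split_ifs <;> simp_all

instance : Finite PosetR := Subtype.finite

/-- A term that expresses an upset of `R` by the atoms of `ε(R)`. -/
noncomputable def upsetTerm (U : eps PosetR) : Term :=
  Term.sups ((Set.toFinite (pts U)).toFinset.toList.map fun S =>
    Term.infs ((Finset.univ \ S.1).toList.map leeTerm))

theorem mem_pts_upsetTerm (e : ℕ → eps PosetR) (U : eps PosetR) (S : PosetR) :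
    S ∈ pts ((upsetTerm U).eval e) ↔ S.image (block e) ∈ pts U := by
  simp only [upsetTerm, mem_pts_sups, mem_pts_infs, List.mem_map, Finset.mem_toList,
    Set.Finite.mem_toFinset, exists_exists_and_eq_and, forall_exists_index, and_imp,
    forall_apply_eq_imp_iff₂, mem_pts_leeTerm, Finset.mem_sdiff, Finset.mem_univ, true_and]
  constructor
  · rintro ⟨T, hT, h⟩
    refine pts_isUpperSet U ?_ hT
    intro i hi
    obtain ⟨m, hm, rfl⟩ := Finset.mem_image.1 hi
    by_contra hn
    exact h _ hn m hm rfl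
  · intro h
    refine ⟨_, h, ?_⟩
    rintro i hi m hm rfl
    exact hi (Finset.mem_image_of_mem _ hm)

/-- If the conclusion fails at some point, all three blocks are non-empty, so every element of `R`
is an image under `block e`, and equal inverse images force `U = V`. -/
theorem eps_R_satisfies_upsetTerm_separated {U V : eps PosetR} (hUV : U ≠ V) :
    (eps PosetR).Satisfies ⟨[(upsetTerm U, upsetTerm V)], leeIdentity.lhs, leeIdentity.rhs⟩ := by
  intro e he
  have he : (upsetTerm U).eval e = (upsetTerm V).eval e := he (_, _) (List.mem_singleton_self _)
  refine pts_ext fun S => ⟨fun _ => mem_pts_top S, fun _ => ?_⟩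
  change (S ∈ pts ((leeTerm 0).eval e) ∨ S ∈ pts ((leeTerm 1).eval e)) ∨
    S ∈ pts ((leeTerm 2).eval e)
  by_contra! hcon
  simp only [mem_pts_leeTerm, not_forall, not_not] at hcon
  have hsurj : Function.Surjective (block e) := by
    intro i
    fin_cases i
    · obtain ⟨m, -, h⟩ := hcon.1.1
      exact ⟨m, h⟩
    · obtain ⟨m, -, h⟩ := hcon.1.2
      exact ⟨m, h⟩
    · obtain ⟨m, -, h⟩ := hcon.2
      exact ⟨m, h⟩
  refine hUV (pts_ext fun T => ?_)
  obtain ⟨T', hT'⟩ : ∃ T' : Finset (Fin 3), T'.image (block e) = T.1 :=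
    ⟨Finset.univ.filter fun m => block e m ∈ T.1, by
      ext i
      obtain ⟨m, rfl⟩ := hsurj i
      simp only [Finset.mem_image, Finset.mem_filter, Finset.mem_univ, true_and]
      exact ⟨fun ⟨k, hk, h⟩ => h ▸ hk, fun h => ⟨m, h, rfl⟩⟩⟩
  have hne : T'.Nonempty := by
    rw [← Finset.image_nonempty (f := block e), hT']
    exact T.nonempty
  obtain ⟨T'', hT⟩ : ∃ T'' : PosetR, T''.image (block e) = T :=
    ⟨⟨T', isMember_R T' hne⟩, Subtype.ext hT'⟩
  rw [← hT, ← mem_pts_upsetTerm, ← mem_pts_upsetTerm, he]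

/-- `ε(R)` embeds in each algebra of `𝐐(ε(R))` outside `Pa 2`. -/
theorem eps_R_satisfies_of_not_lee {A : PAlg.{u}} (hA : A ∈ Q.{u, 0} (eps PosetR))
    (hL : ¬ Lee A) {q : QuasiIdentity} (hq : A.Satisfies q) : (eps PosetR).Satisfies q := by
  have hL' : ∃ x y : A, xᶜ ⊔ (y ⊓ xᶜ)ᶜ ⊔ (xᶜ ⊓ yᶜ)ᶜ ≠ ⊤ := by
    unfold Lee at hL
    push Not at hL
    exact hL
  obtain ⟨x, y, hxy⟩ := hL'
  let e : ℕ → A := fun n => if n = 0 then x else y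
  -- Identities of $\varepsilon(R)$ hold in `A`; each homomorphism law below is one of them.
  have key : ∀ s t : Term, (∀ (e' : ℕ → eps PosetR) S, S ∈ pts (s.eval e') ↔ S ∈ pts (t.eval e')) →
      s.eval e = t.eval e := fun s t hst =>
    hA ⟨[], s, t⟩ (fun e' _ => pts_ext (hst e')) e (by simp)
  refine hq.of_separating (I := Unit) (fun _ U => (upsetTerm U).eval e) (fun _ => ?_) ?_
  · refine ⟨key _ .bot ?_, key _ .top ?_, fun U V => key _ (.inf (upsetTerm U) (upsetTerm V)) ?_,
      fun U V => key _ (.sup (upsetTerm U) (upsetTerm V)) ?_,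
      fun U => key _ (.star (upsetTerm U)) ?_⟩
    · intro e' S
      rw [mem_pts_upsetTerm]
      exact Iff.rfl
    · intro e' S
      rw [mem_pts_upsetTerm]
      exact Iff.rfl
    · intro e' S
      rw [mem_pts_upsetTerm]
      exact and_congr (mem_pts_upsetTerm e' U S).symm (mem_pts_upsetTerm e' V S).symm
    · intro e' S
      rw [mem_pts_upsetTerm]
      exact or_congr (mem_pts_upsetTerm e' U S).symm (mem_pts_upsetTerm e' V S).symm
    · intro e' S
      have hF : ∅ ∉ ({{1, 2}, Finset.univ \ {1}, Finset.univ \ {2}} : Finset (Finset (Fin 3))) := by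
        decide
      rw [mem_pts_upsetTerm, mem_pts_compl_iff hF]
      refine Iff.trans ?_ (mem_pts_compl_iff hF ((upsetTerm U).eval e') S).symm
      simp only [mem_pts_upsetTerm]
      have himg : ∀ m, PosetR.image (block e') (single m) = single (block e' m) := fun m =>
        Subtype.ext (Finset.image_singleton _ _)
      simp only [himg]
      exact Finset.forall_mem_image
  · intro U V h
    by_contra hUV
    refine hxy (hA _ (eps_R_satisfies_upsetTerm_separated hUV) e fun p hp => ?_)
    rw [List.mem_singleton.1 hp]
    exact h ()

/-! ### `B̄₂` inside `ε(R)` -/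

/-- The map of bases that induces the embedding of `B̄₂` in `ε(R)`. -/
def collapse : Fin 3 → Fin 2 := ![0, 1, 1]

/-- The embedding of `B̄₂` in `ε(R)`. -/
def ofBbar (x : WithTop (Set (Fin 2))) : eps PosetR :=
  ofUpper {S | x = ⊤ ∨ ∃ i, (({i} : Set (Fin 2)) : WithTop (Set (Fin 2))) ≤ x ∧
    ∀ m ∈ S.1, collapse m = i} (by
      rintro S T hST (h | ⟨i, hi, h⟩)
      · exact Or.inl h
      · exact Or.inr ⟨i, hi, fun m hm => h m (hST hm)⟩)

theorem mem_pts_ofBbar_top (S : PosetR) : S ∈ pts (ofBbar ⊤) := Or.inl rfl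

theorem mem_pts_ofBbar_coe (s : Set (Fin 2)) (S : PosetR) :
    S ∈ pts (ofBbar s) ↔ ∃ i ∈ s, ∀ m ∈ S.1, collapse m = i := by
  change (_ ∨ _) ↔ _
  simp [WithTop.coe_le_coe]

theorem eq_of_collapse {S : PosetR} {i j : Fin 2} (hi : ∀ m ∈ S.1, collapse m = i)
    (hj : ∀ m ∈ S.1, collapse m = j) : i = j := by
  obtain ⟨m, hm⟩ := S.nonempty
  exact (hi m hm).symm.trans (hj m hm)

theorem single_mem_pts_ofBbar (s : Set (Fin 2)) (m : Fin 3) :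
    single m ∈ pts (ofBbar s) ↔ collapse m ∈ s := by
  rw [mem_pts_ofBbar_coe]
  simp [single]

theorem isHom_ofBbar : IsHom (α := Bbar 2) ofBbar where
  map_bot := pts_ext fun S => by
    change S ∈ pts (ofBbar ((∅ : Set (Fin 2)) : WithTop (Set (Fin 2)))) ↔ S ∈ pts (⊥ : eps PosetR)
    simp [mem_pts_ofBbar_coe, notMem_pts_bot]
  map_top := pts_ext fun S => ⟨fun _ => mem_pts_top S, fun _ => mem_pts_ofBbar_top S⟩
  map_inf := by
    intro x y
    change WithTop (Set (Fin 2)) at x y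
    change ofBbar (x ⊓ y) = _
    refine pts_ext fun S => ?_
    rw [mem_pts_inf]
    induction x using WithTop.recTopCoe with
    | top => simp [mem_pts_ofBbar_top]
    | coe s =>
      induction y using WithTop.recTopCoe with
      | top => simp [mem_pts_ofBbar_top]
      | coe t =>
        rw [← WithTop.coe_inf]
        simp only [mem_pts_ofBbar_coe]
        constructor
        · rintro ⟨i, ⟨hs, ht⟩, h⟩
          exact ⟨⟨i, hs, h⟩, i, ht, h⟩
        · rintro ⟨⟨i, hs, h⟩, j, ht, h'⟩
          exact ⟨i, ⟨hs, eq_of_collapse h h' ▸ ht⟩, h⟩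
  map_sup := by
    intro x y
    change WithTop (Set (Fin 2)) at x y
    change ofBbar (x ⊔ y) = _
    refine pts_ext fun S => ?_
    rw [mem_pts_sup]
    induction x using WithTop.recTopCoe with
    | top => simp [mem_pts_ofBbar_top]
    | coe s =>
      induction y using WithTop.recTopCoe with
      | top => simp [mem_pts_ofBbar_top]
      | coe t =>
        rw [← WithTop.coe_sup]
        simp only [mem_pts_ofBbar_coe]
        constructor
        · rintro ⟨i, hs | ht, h⟩
          · exact Or.inl ⟨i, hs, h⟩
          · exact Or.inr ⟨i, ht, h⟩
        · rintro (⟨i, hs, h⟩ | ⟨i, ht, h⟩)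
          · exact ⟨i, Or.inl hs, h⟩
          · exact ⟨i, Or.inr ht, h⟩
  map_compl := by
    intro x
    change WithTop (Set (Fin 2)) at x
    refine pts_ext fun S => ?_
    rw [mem_pts_compl_iff (by decide)]
    induction x using WithTop.recTopCoe with
    | top =>
      rw [Bbar_compl_top]
      refine iff_of_false ?_ fun h => ?_
      · simp [mem_pts_ofBbar_coe]
      · obtain ⟨m, hm⟩ := S.nonempty
        exact h m hm (mem_pts_ofBbar_top _)
    | coe s =>
      by_cases hs : s = ∅
      · subst hs
        rw [Bbar_compl_empty]
        refine iff_of_true (mem_pts_ofBbar_top _) fun m _ => ?_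
        simp [mem_pts_ofBbar_coe]
      · rw [Bbar_compl_coe hs, mem_pts_ofBbar_coe]
        simp only [single_mem_pts_ofBbar]
        constructor
        · rintro ⟨i, hi, h⟩ m hm
          rwa [h m hm]
        · intro h
          obtain ⟨j, hj⟩ := Set.nonempty_iff_ne_empty.2 hs
          have hne : ∀ m ∈ S.1, collapse m ≠ j := fun m hm hmj => h m hm (hmj ▸ hj)
          obtain ⟨k, hk⟩ := S.nonempty
          refine ⟨collapse k, h k hk, fun m hm => ?_⟩
          have h1 := hne m hm
          have h2 := hne k hk
          -- In `Fin 2`, two elements that both differ from `j` are equal.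
          omega

theorem ofBbar_injective : Function.Injective ofBbar := by
  have hbase : ∀ s : Set (Fin 2), base ∉ pts (ofBbar s) := by
    intro s h
    obtain ⟨i, -, h⟩ := (mem_pts_ofBbar_coe s _).1 h
    have h0 := h 0 (Finset.mem_univ _)
    have h1 := h 1 (Finset.mem_univ _)
    exact absurd (h0.trans h1.symm) (by decide)
  intro x y h
  induction x using WithTop.recTopCoe with
  | top =>
    induction y using WithTop.recTopCoe with
    | top => rfl
    | coe t => exact (hbase t (h ▸ mem_pts_ofBbar_top _)).elim
  | coe s =>
    induction y using WithTop.recTopCoe with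
    | top => exact (hbase s (h ▸ mem_pts_ofBbar_top _)).elim
    | coe t =>
      congr 1
      ext i
      obtain ⟨m, rfl⟩ : ∃ m, collapse m = i := by
        revert i
        decide
      rw [← single_mem_pts_ofBbar, h, single_mem_pts_ofBbar]

/-! ### The chain of quasivarieties -/

theorem not_lee_eps_R : ¬ Lee (eps PosetR) := by
  have hF : ∅ ∉ ({{1, 2}, Finset.univ \ {1}, Finset.univ \ {2}} : Finset (Finset (Fin 3))) := by
    decide
  intro h
  -- Without regularity premises, the quasi-identity would follow from Lee's identity.
  refine not_satisfies_disjointQuasiIdentity hF [] (fun n => if n = 0 then 0 else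
    if n = 1 then 1 else 2) (by decide) (by decide) (by decide)
    (by simp) fun e he => ?_
  have h10 : e 0 ⊓ e 1 = ⊥ := he (.inf (.var 0) (.var 1), .bot) (by
    simp [disjointQuasiIdentity, disjointPremises])
  have h20 : e 0 ⊓ e 2 = ⊥ := he (.inf (.var 0) (.var 2), .bot) (by
    simp [disjointQuasiIdentity, disjointPremises])
  have h21 : e 1 ⊓ e 2 = ⊥ := he (.inf (.var 1) (.var 2), .bot) (by
    simp [disjointQuasiIdentity, disjointPremises])
  rw [inf_comm] at h10 h20 h21
  exact h.of_disjoint h10 h20 h21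

theorem Pa_two_ssubset : Pa.{u} 2 ⊂ Q.{u, 0} (eps PosetR) := by
  refine ⟨fun A hA q hq => satisfies_of_mem_Pa_two hA (hq.of_separating (I := Unit)
    (fun _ => ofBbar) (fun _ => isHom_ofBbar) fun x y h => ofBbar_injective (h ())), fun h => ?_⟩
  have hmem : lift.{u} (eps PosetR) ∈ Pa.{u} 2 := h fun q hq => (lift_satisfies _ q).2 hq
  rw [mem_Pa_two_iff, ← satisfies_leeIdentity_iff, lift_satisfies, satisfies_leeIdentity_iff] at hmem
  exact not_lee_eps_R hmem

set_option synthInstance.maxSize 1000 in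
set_option synthInstance.maxHeartbeats 400000 in
set_option maxRecDepth 10000 in
theorem Q_eps_R_ssubset : Q.{u, 0} (eps PosetR) ⊂ Q.{u, 0} (eps PosetQ) := by
  refine Q_ssubset (fun q => satisfies_of_base_maps (by decide) (by decide))
    (disjointQuasiIdentity ([(0, 2)].map fun p => regularPremise p.1 p.2))
    (satisfies_disjointQuasiIdentity (by decide) _ fun m _ _ _ =>
      Or.inl ⟨by simp, isMember_R _ (Finset.insert_nonempty _ _)⟩)
    -- Variables `0` and `2` receive the atoms of `0` and `1`, since `{0, 1}` is the pair absent
    -- from `Q`; in `R` no pair is absent.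
    (not_satisfies_disjointQuasiIdentity (by decide) _ (fun n => if n = 0 then 0 else
      if n = 1 then 2 else 1) (by decide) (by decide) (by decide) (by decide))

set_option synthInstance.maxSize 1000 in
set_option synthInstance.maxHeartbeats 400000 in
set_option maxRecDepth 10000 in
theorem Q_eps_Q_ssubset : Q.{u, 0} (eps PosetQ) ⊂ Q.{u, 0} (eps PosetP) := by
  refine Q_ssubset (fun q => satisfies_of_base_maps (by decide) (by decide))
    (disjointQuasiIdentity ([(0, 2), (1, 2)].map fun p => regularPremise p.1 p.2))
    (satisfies_disjointQuasiIdentity (by decide) _ fun m h01 h02 h12 => ?_)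
    -- Variable `2`, shared by both regular joins, receives the atom of `0`, the point that lies in
    -- no pair of `P`.
    (not_satisfies_disjointQuasiIdentity (by decide) _ (fun n => if n = 0 then 1 else
      if n = 1 then 2 else 0) (by decide) (by decide) (by decide) (by decide))
  -- In `Q` every point lies in some pair.
  have key : ∀ a b c : Fin 3, a ≠ b → a ≠ c → b ≠ c →
      IsMember {{1, 2}, Finset.univ \ {1}} {a, c} ∨
        IsMember {{1, 2}, Finset.univ \ {1}} {b, c} := by decide
  exact (key _ _ _ h01 h02 h12).imp (fun h => ⟨by simp, h⟩) fun h => ⟨by simp, h⟩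

theorem isCover_Q_eps_R : IsCover (Pa.{u} 2) (Q.{u, 0} (eps PosetR)) := by
  refine ⟨isQuasivariety_Pa_two, isQuasivariety_Q _, Pa_two_ssubset, ?_⟩
  rintro K ⟨S, rfl⟩ hPa hQ
  -- Either `K` stays inside $\mathsf{Pa}_2$, or some member violates Lee's identity and
  -- $\varepsilon(R)$ inherits its quasi-identities, in particular those of `S`.
  by_cases hL : ∀ A : PAlg.{u}, (∀ q ∈ S, A.Satisfies q) → Lee A
  · exact Or.inl (Set.Subset.antisymm (fun A hA => mem_Pa_two_iff.2 (hL A hA)) hPa)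
  · push Not at hL
    obtain ⟨A, hA, hL⟩ := hL
    exact Or.inr (Set.Subset.antisymm hQ fun B hB q hq =>
      hB q (eps_R_satisfies_of_not_lee (hQ hA) hL (hA q hq)))

theorem not_isCover_of_between {K L N : Set PAlg.{u}} (hL : IsQuasivariety L) (hKL : K ⊂ L)
    (hLN : L ⊂ N) : ¬ IsCover K N := fun h =>
  (h.2.2.2 L hL hKL.subset hLN.subset).elim hKL.ne' hLN.ne

end PAlg

theorem mainTheorem7 :
    (PAlg.Pa.{u} 2 ⊂ PAlg.Q.{u, 0} (PAlg.eps PAlg.PosetR) ∧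
      PAlg.Q.{u, 0} (PAlg.eps PAlg.PosetR) ⊂ PAlg.Q.{u, 0} (PAlg.eps PAlg.PosetQ) ∧
      PAlg.Q.{u, 0} (PAlg.eps PAlg.PosetQ) ⊂ PAlg.Q.{u, 0} (PAlg.eps PAlg.PosetP)) ∧
    PAlg.IsCover (PAlg.Pa.{u} 2) (PAlg.Q.{u, 0} (PAlg.eps PAlg.PosetR)) ∧
    ¬ PAlg.IsCover (PAlg.Pa.{u} 2) (PAlg.Q.{u, 0} (PAlg.eps PAlg.PosetQ)) ∧
    ¬ PAlg.IsCover (PAlg.Pa.{u} 2) (PAlg.Q.{u, 0} (PAlg.eps PAlg.PosetP)) :=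
  ⟨⟨PAlg.Pa_two_ssubset, PAlg.Q_eps_R_ssubset, PAlg.Q_eps_Q_ssubset⟩, PAlg.isCover_Q_eps_R,
    PAlg.not_isCover_of_between (PAlg.isQuasivariety_Q _) PAlg.Pa_two_ssubset PAlg.Q_eps_R_ssubset,
    PAlg.not_isCover_of_between (PAlg.isQuasivariety_Q _)
      PAlg.Pa_two_ssubset (PAlg.Q_eps_R_ssubset.trans PAlg.Q_eps_Q_ssubset)⟩
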